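/- Let $S$ be a scheme, $p$ a prime number and $k$ a perfect field of characteristic $p$, and let $\operatorname{Spec}(k)$ be regarded as a scheme over $S$ via a morphism $\operatorname{Spec}(k)\to S$. An algebraic space over $S$ is a sheaf of sets $F$ on the big fppf site $(\mathrm{Sch}/S)_{fppf}$ whose diagonal $F\to F\times F$ is representable by schemes and which admits a surjective étale morphism $h_U\to F$ from an $S$-scheme $U$, where $h_U$ denotes the functor represented by $U$. A morphism $F\to G$ of algebraic spaces over $S$ is étale if for every $S$-scheme $U$ and every étale morphism $h_U\to F$ the composite $h_U\to F\to G$ is étale, where a morphism from a scheme to an algebraic space over $S$ is called étale if its base change to every $S$-scheme is an étale morphism of schemes. A scheme is perfect if it has characteristic $p$ (that is, $p=0$ in its structure sheaf) and its absolute Frobenius morphism is an isomorphism. An algebraic space $F$ over $S$ is perfect if there is a surjective étale morphism $h_U\to F$ with $U$ an $S$-scheme which is perfect. Let $X$ be an algebraic space over $S$. If $X$ is étale over $k$, that is, if there is an étale morphism $X\to h_{\operatorname{Spec}(k)}$ of algebraic spaces over $S$, then $X$ is perfect. -/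

import Mathlib

open CategoryTheory Limits AlgebraicGeometry Opposite

universe u

noncomputable section

namespace PerfectSpaces

/-! ### Perfect schemes -/

/-- The `p`-th power map of a commutative ring in which the prime `p` is zero (the zero ring is
allowed), as a ring homomorphism. -/
def powHom (p : ℕ) [hp : Fact p.Prime] (R : Type*) [CommRing R] (h : (p : R) = 0) : R →+* R where
  toFun x := x ^ p
  map_one' := one_pow p
  map_mul' x y := mul_pow x y p
  map_zero' := zero_pow hp.out.ne_zero
  map_add' x y := by
    obtain ⟨r, hr⟩ := exists_add_pow_prime_eq hp.out x y
    rw [hr, h]; ring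

/-- A scheme has characteristic `p` if `p` is zero in its structure sheaf. -/
def HasChar (p : ℕ) (X : Scheme.{u}) : Prop :=
  ∀ U : X.Opens, (p : Γ(X, U)) = 0

/-- The endomorphism `g ↦ g ^ p` of the structure sheaf of a scheme of characteristic `p`, on top
of the identity of the underlying space. -/
def frobeniusPresheafedSpace (p : ℕ) [Fact p.Prime] (X : Scheme.{u}) (hX : HasChar p X) :
    X.toPresheafedSpace.Hom X.toPresheafedSpace where
  base := 𝟙 _
  c :=
    { app := fun U => CommRingCat.ofHom (powHom p Γ(X, U.unop) (hX U.unop))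
      naturality := by
        intro U V i
        ext x
        exact (map_pow (X.presheaf.map i).hom x p).symm }

theorem frobenius_stalkMap (p : ℕ) [Fact p.Prime] (X : Scheme.{u}) (hX : HasChar p X) (x : X)
    (a : X.presheaf.stalk x) :
    ((frobeniusPresheafedSpace p X hX).stalkMap x).hom a = a ^ p := by
  obtain ⟨U, hU, s, rfl⟩ := TopCat.Presheaf.exists_germ_eq X.presheaf a
  have h := PresheafedSpace.stalkMap_germ_apply
    (frobeniusPresheafedSpace p X hX) U x hU s
  refine h.trans ?_
  exact map_pow (X.presheaf.germ U x hU).hom s p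

/-- The absolute Frobenius morphism of a scheme of characteristic `p`: the identity on the
underlying space, and `g ↦ g ^ p` on the structure sheaf. -/
def absoluteFrobenius (p : ℕ) [hp : Fact p.Prime] (X : Scheme.{u}) (hX : HasChar p X) : X ⟶ X where
  toHom := frobeniusPresheafedSpace p X hX
  prop x := by
    constructor
    intro a ha
    rw [frobenius_stalkMap p X hX x a] at ha
    exact (isUnit_pow_iff hp.out.ne_zero).1 ha

/-- A scheme is perfect (with respect to the prime `p`) if it has characteristic `p` and its
absolute Frobenius morphism is an isomorphism. -/
def IsPerfectScheme (p : ℕ) [Fact p.Prime] (X : Scheme.{u}) : Prop :=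
  ∃ hX : HasChar p X, IsIso (absoluteFrobenius p X hX)

/-! ### Algebraic spaces -/

variable {S : Scheme.{u}}

/-- Étale morphisms in the category of schemes over `S`. -/
def etaleOver (S : Scheme.{u}) : MorphismProperty (Over S) :=
  MorphismProperty.inverseImage @Etale (Over.forget S)

/-- Surjective étale morphisms in the category of schemes over `S`. -/
def surjectiveEtaleOver (S : Scheme.{u}) : MorphismProperty (Over S) :=
  MorphismProperty.inverseImage (@Surjective ⊓ @Etale) (Over.forget S)

/-- A set-valued presheaf `F` on the category of schemes over `S` is an algebraic space over `S` if
it is a sheaf for the fppf topology, its diagonal `F ⟶ F ⨯ F` is representable (by schemes), and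
there are a scheme `U` over `S` and a surjective étale morphism `h_U ⟶ F` (that is, a representable
morphism whose base change to any scheme over `S` is surjective étale). -/
structure IsAlgebraicSpace (F : (Over S)ᵒᵖ ⥤ Type u) : Prop where
  isSheaf : Presheaf.IsSheaf (Scheme.fppfTopology.{u}.over S) F
  representable_diag : yoneda.relativelyRepresentable (diag F)
  exists_atlas : ∃ (U : Over S) (φ : yoneda.obj U ⟶ F), (surjectiveEtaleOver S).presheaf φ

/-- A morphism `f : F ⟶ G` of algebraic spaces over `S` is étale if for every scheme `U` over `S`
and every étale morphism `φ : h_U ⟶ F`, the composite `h_U ⟶ F ⟶ G` is étale. Morphisms from a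
scheme to an algebraic space are representable, and such a morphism is étale if its base change to
any scheme over `S` is étale. -/
def IsEtale {F G : (Over S)ᵒᵖ ⥤ Type u} (f : F ⟶ G) : Prop :=
  ∀ (U : Over S) (φ : yoneda.obj U ⟶ F),
    (etaleOver S).presheaf φ → (etaleOver S).presheaf (φ ≫ f)

/-- A perfect algebraic space over `S` (with respect to the prime `p`): an algebraic space `F` with
a surjective étale morphism `h_U ⟶ F`, where `U` is a scheme over `S` that is perfect. -/
structure IsPerfectAlgebraicSpace (p : ℕ) [Fact p.Prime] (F : (Over S)ᵒᵖ ⥤ Type u) : Prop where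
  isAlgebraicSpace : IsAlgebraicSpace F
  exists_perfect_atlas : ∃ (U : Over S) (φ : yoneda.obj U ⟶ F),
    IsPerfectScheme p U.left ∧ (surjectiveEtaleOver S).presheaf φ

end PerfectSpaces

end

namespace PerfectSpaces

/-! Any étale atlas `U` of `X` is already perfect: composed with `X ⟶ h_{Spec k}` it is étale, and
by Yoneda it comes from an étale morphism of schemes `U ⟶ Spec k`. Sections of `U` over affine opens
are then étale `k`-algebras, i.e. finite products of finite separable extensions of `k`; these
fields are perfect, so Frobenius is bijective. -/

/-- The `p`-th power map is bijective on an étale algebra over a perfect field of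
characteristic `p`. -/
theorem bijective_pow_of_etale (p : ℕ) [Fact p.Prime] (k A : Type u) [Field k] [CharP k p]
    [PerfectField k] [CommRing A] [Algebra k A] [Algebra.Etale k A] :
    Function.Bijective fun x : A => x ^ p := by
  obtain ⟨I, _, K, _, _, e, hK⟩ := (Algebra.Etale.iff_exists_algEquiv_prod k A).1 inferInstance
  have key (i : I) : Function.Bijective fun x : K i => x ^ p := by
    have := (hK i).1
    have : CharP (K i) p := charP_of_injective_algebraMap (algebraMap k (K i)).injective p
    have : PerfectField (K i) := Algebra.IsAlgebraic.perfectField k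
    exact bijective_frobenius (K i) p
  have hpi : Function.Bijective fun x : (∀ i, K i) => x ^ p :=
    ⟨fun x y h => funext fun i => (key i).1 (congrFun h i),
      fun y => ⟨fun i => ((key i).2 (y i)).choose, funext fun i => ((key i).2 (y i)).choose_spec⟩⟩
  have h : (fun x : A => x ^ p) = e.symm ∘ (fun x : (∀ i, K i) => x ^ p) ∘ e := by
    funext x
    simp
  rw [h]
  exact e.symm.bijective.comp (hpi.comp e.bijective)

/-- A scheme over a field of characteristic `p` has characteristic `p`. -/
theorem HasChar.of_hom_spec_field (p : ℕ) (k : Type u) [Field k] [CharP k p] {X : Scheme.{u}}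
    (f : X ⟶ Spec (CommRingCat.of k)) : HasChar p X := by
  intro U
  have h := map_natCast
    ((Scheme.ΓSpecIso (CommRingCat.of k)).inv ≫ f.appLE ⊤ U le_top).hom p
  rw [← h]
  have h0 : ((p : ℕ) : CommRingCat.of k) = 0 := CharP.cast_eq_zero k p
  rw [h0, map_zero]

/-- If the `p`-th power map is bijective on the sections over every affine open, then the
absolute Frobenius morphism is an isomorphism. -/
theorem isIso_absoluteFrobenius (p : ℕ) [Fact p.Prime] (X : Scheme.{u}) (hX : HasChar p X)
    (h : ∀ U : X.affineOpens, Function.Bijective fun x : Γ(X, U) => x ^ p) :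
    IsIso (absoluteFrobenius p X hX) := by
  change MorphismProperty.isomorphisms Scheme (absoluteFrobenius p X hX)
  refine (@HasAffineProperty.iff_of_iSup_eq_top _ _
    instHasAffinePropertyIsomorphismsSchemeAndIsAffineIsIsoCommRingCatAppTop _ _ _ _
    (fun U : X.affineOpens => U) (iSup_affineOpens_eq_top X)).2 fun U => ?_
  -- Frobenius is the identity on points, so the preimage of `U` is `U` itself, hence affine.
  refine ⟨U.2, ?_⟩
  have hU : IsAffineOpen (U.1.ι ''ᵁ ⊤) := by
    rw [Scheme.Opens.ι_image_top]
    exact U.2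
  have : IsIso ((absoluteFrobenius p X hX).app (U.1.ι ''ᵁ ⊤)) :=
    (ConcreteCategory.isIso_iff_bijective _).2 (h ⟨_, hU⟩)
  -- Global sections of the restriction are the `p`-th power map up to a restriction isomorphism.
  rw [morphismRestrict_appTop]
  exact IsIso.comp_isIso' this (Functor.map_isIso _ _)

/-- A scheme étale over a perfect field of characteristic `p` is perfect. -/
theorem IsPerfectScheme.of_etale_field (p : ℕ) [Fact p.Prime] (k : Type u) [Field k] [CharP k p]
    [PerfectField k] {X : Scheme.{u}} (f : X ⟶ Spec (CommRingCat.of k)) [Etale f] :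
    IsPerfectScheme p X := by
  refine ⟨.of_hom_spec_field p k f, isIso_absoluteFrobenius p X _ fun U => ?_⟩
  have h1 := f.etale_appLE (isAffineOpen_top _) U.2 le_top
  have h2 : ((Scheme.ΓSpecIso (CommRingCat.of k)).inv ≫ f.appLE ⊤ U le_top).hom.Etale :=
    (RingHom.Etale.respectsIso.2 _ (Scheme.ΓSpecIso (CommRingCat.of k)).symm.commRingCatIsoToRingEquiv h1 :)
  algebraize [((Scheme.ΓSpecIso (CommRingCat.of k)).inv ≫ f.appLE ⊤ U le_top).hom]
  exact bijective_pow_of_etale p k Γ(X, U)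

end PerfectSpaces

theorem mainTheorem7 (S : Scheme.{u}) (p : ℕ) [Fact p.Prime]
    (k : Type u) [Field k] [CharP k p] [PerfectField k]
    (s : Spec (CommRingCat.of k) ⟶ S)
    (X : (Over S)ᵒᵖ ⥤ Type u) (hX : PerfectSpaces.IsAlgebraicSpace X)
    (f : X ⟶ yoneda.obj (Over.mk s)) (hf : PerfectSpaces.IsEtale f) :
    PerfectSpaces.IsPerfectAlgebraicSpace p X := by
  obtain ⟨U, φ, hφ⟩ := hX.exists_atlas
  refine ⟨hX, U, φ, ?_, hφ⟩
  have hle : PerfectSpaces.surjectiveEtaleOver S ≤ PerfectSpaces.etaleOver S := fun _ _ _ h => h.2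
  have hφf := hf U φ (MorphismProperty.relative_monotone hle _ hφ)
  -- Fullness of Yoneda turns the composite into a morphism of schemes over `S`.
  obtain ⟨g, hg⟩ := yoneda.map_surjective (φ ≫ f)
  rw [← hg] at hφf
  have hgE : PerfectSpaces.etaleOver S g := MorphismProperty.of_relative_map hφf
  have : Etale g.left := hgE
  exact PerfectSpaces.IsPerfectScheme.of_etale_field p k g.left
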